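/- **Setting.** Let $q\ge 0$ be real. For $n\ge 0$ and $0\le k\le n$ put $[n]=\sum_{k=0}^{n-1}q^k$, $[n]!=\prod_{i=1}^n[i]$, $\genfrac{[}{]}{0pt}{}{n}{k}=\frac{[n]!}{[k]!\,[n-k]!}$, and $(t;q)_n=\prod_{i=0}^{n-1}(1-tq^i)$. A configuration is a tuple $c=(c_1,\dots,c_n)$ of non-negative integers with $\sum_i c_i=n$. Drop $n$ balls one at a time, in any order, onto the sites of $\mathbb Z$, where $c_i$ of the balls are dropped at site $i$ for each $i\in\{1,\dots,n\}$. A ball that lands on an empty site stays there; as long as a ball lands on an occupied site it moves one site left with probability $q/(1+q)$ and one site right with probability $1/(1+q)$. The probability $\mathbb P(c\to\{1,\dots,n\})_q$ that the final set of occupied sites is $\{1,\dots,n\}$ does not depend on the order. The remixed Eulerian number of $c$ is $A_c(q)=[n]!\;\mathbb P(c\to\{1,\dots,n\})_q$. For integers $x,y\ge 1$ and $r,s\ge 0$ put $$A(r,s|x,y)_q=\frac{1}{[x+y-1]!}\,A_{(0^r,\,1^{y-1},\,r+s+1,\,1^{x-1},\,0^s)}(q).$$ **Proposition.** Let $q\ge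 0$ be real and let $x,y\ge 1$ be integers. For all integers $r,s\ge 0$ (only $r+s$ matters here), as formal power series in $t$, $$\frac{\sum_{i=0}^{r+s}t^i A(i,r+s-i|x,y)_q}{(t;q)_{r+s+x+y}}=\sum_{j\ge 0}t^j\genfrac{[}{]}{0pt}{}{j+x+y-1}{j}[j+y]^{r+s}.$$ Equivalently, extracting the coefficient of $t^r$ of the numerator, for all integers $r,s\ge 0$, $$A(r,s|x,y)_q=\sum_{j=0}^{r}(-1)^{r+j}q^{\binom{r-j}{2}}\genfrac{[}{]}{0pt}{}{j+x+y-1}{j}\genfrac{[}{]}{0pt}{}{r+s+x+y}{r-j}[j+y]^{r+s}.$$ -/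

import Mathlib

open scoped NNReal ENNReal

namespace RemixedEulerian

/-! ### The particle model -/

/-- One flip of the coin that moves a ball left (`true`, with probability `q / (1 + q)`) or
right (`false`, with probability `1 / (1 + q)`). -/
noncomputable def coin (q : ℝ≥0) : PMF Bool :=
  PMF.ofFintype (fun b => cond b ((q / (1 + q) : ℝ≥0) : ℝ≥0∞) ((1 / (1 + q) : ℝ≥0) : ℝ≥0∞)) (by
    have h : (1 + q : ℝ≥0) ≠ 0 := by positivity
    rw [Fintype.sum_bool, cond_true, cond_false, ← ENNReal.coe_add, ← add_div, add_comm q 1,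
      div_self h, ENNReal.coe_one])

/-- A state of the dynamic: the set of sites that hold a ball at rest, and the list of the present
positions of the other balls in the order in which they are dropped. The head of the list is the
ball that is moving now. -/
abbrev State := Finset ℤ × List ℤ

/-- One step of the dynamic. A ball on a hole comes to rest there. A ball on top of
another ball moves one site left with probability `q / (1 + q)`, and one site right with
probability `1 / (1 + q)`. A state in which all balls are at rest does not change. -/
noncomputable def step (q : ℝ≥0) : State → PMF State
  | (S, []) => PMF.pure (S, [])
  | (S, j :: u) =>
      if j ∈ S then
        (coin q).map fun left => if left then (S, (j - 1) :: u) else (S, (j + 1) :: u)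
      else PMF.pure (insert j S, u)

/-- The law of the state after `k` steps of the dynamic. -/
noncomputable def run (q : ℝ≥0) : ℕ → State → PMF State
  | 0, s => PMF.pure s
  | k + 1, s => (step q s).bind (run q k)

/-- The probability that the dynamic started in the state `s` ends with all balls at rest and
with support `T`. As such a final state never changes, the probability to have reached it after `k`
steps is nondecreasing in `k`, and its supremum is the probability to reach it at all. -/
noncomputable def endProb (q : ℝ≥0) (T : Finset ℤ) (s : State) : ℝ≥0∞ :=
  ⨆ k : ℕ, run q k s (T, [])

/-! ### The order in which the balls are dropped does not matter -/

theorem run_apply_nil (q : ℝ≥0) (T S : Finset ℤ) (k : ℕ) :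
    run q k (S, []) (T, []) = if S = T then 1 else 0 := by
  induction k with
  | zero => simp [run, PMF.pure_apply, eq_comm]
  | succ k ih => simpa [run, step] using ih

theorem run_succ_apply_mem (q : ℝ≥0) (T S : Finset ℤ) (k : ℕ) (j : ℤ) (u : List ℤ) (h : j ∈ S) :
    run q (k + 1) (S, j :: u) (T, []) =
      ((q / (1 + q) : ℝ≥0) : ℝ≥0∞) * run q k (S, (j - 1) :: u) (T, []) +
      ((1 / (1 + q) : ℝ≥0) : ℝ≥0∞) * run q k (S, (j + 1) :: u) (T, []) := by
  simp only [run, step, if_pos h, PMF.bind_map, PMF.bind_apply, tsum_fintype, Fintype.sum_bool]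
  simp [coin, PMF.ofFintype_apply]

theorem run_succ_apply_notMem (q : ℝ≥0) (S : Finset ℤ) (k : ℕ) (j : ℤ) (u : List ℤ)
    (h : j ∉ S) :
    run q (k + 1) (S, j :: u) = run q k (insert j S, u) := by
  simp [run, step, if_neg h]

theorem run_mono (q : ℝ≥0) (T : Finset ℤ) (s : State) :
    Monotone fun k => run q k s (T, []) := by
  refine monotone_nat_of_le_succ fun k => ?_
  induction k generalizing s with
  | zero =>
    obtain ⟨S, u⟩ := s
    cases u with
    | nil => rw [run_apply_nil, run_apply_nil]
    | cons j u => simp [run, PMF.pure_apply]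
  | succ k ih =>
    obtain ⟨S, u⟩ := s
    cases u with
    | nil => rw [run_apply_nil, run_apply_nil]
    | cons j u =>
      by_cases h : j ∈ S
      · rw [run_succ_apply_mem q T S k j u h, run_succ_apply_mem q T S (k + 1) j u h]
        gcongr
        · exact ih _
        · exact ih _
      · rw [run_succ_apply_notMem q S k j u h, run_succ_apply_notMem q S (k + 1) j u h]
        exact ih _

theorem endProb_eq_succ (q : ℝ≥0) (T : Finset ℤ) (s : State) :
    endProb q T s = ⨆ k : ℕ, run q (k + 1) s (T, []) :=
  ((run_mono q T s).iSup_nat_add 1).symm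

theorem endProb_le_one (q : ℝ≥0) (T : Finset ℤ) (s : State) : endProb q T s ≤ 1 :=
  iSup_le fun _ => PMF.coe_le_one _ _

theorem endProb_ne_top (q : ℝ≥0) (T : Finset ℤ) (s : State) : endProb q T s ≠ ⊤ :=
  ne_top_of_le_ne_top ENNReal.one_ne_top (endProb_le_one q T s)

theorem endProb_nil (q : ℝ≥0) (T S : Finset ℤ) :
    endProb q T (S, []) = if S = T then 1 else 0 := by
  simp [endProb, run_apply_nil]

theorem endProb_notMem (q : ℝ≥0) (T S : Finset ℤ) (j : ℤ) (u : List ℤ) (h : j ∉ S) :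
    endProb q T (S, j :: u) = endProb q T (insert j S, u) := by
  rw [endProb_eq_succ]
  simp only [run_succ_apply_notMem q S _ j u h]
  rfl

theorem endProb_mem (q : ℝ≥0) (T S : Finset ℤ) (j : ℤ) (u : List ℤ) (h : j ∈ S) :
    endProb q T (S, j :: u) =
      ((q / (1 + q) : ℝ≥0) : ℝ≥0∞) * endProb q T (S, (j - 1) :: u) +
      ((1 / (1 + q) : ℝ≥0) : ℝ≥0∞) * endProb q T (S, (j + 1) :: u) := by
  rw [endProb_eq_succ]
  simp only [run_succ_apply_mem q T S _ j u h]
  rw [← ENNReal.iSup_add_iSup_of_monotone, ← ENNReal.mul_iSup, ← ENNReal.mul_iSup]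
  · rfl
  · exact fun a b hab => mul_le_mul_right (run_mono q T _ hab) _
  · exact fun a b hab => mul_le_mul_right (run_mono q T _ hab) _

/-- A function on the sites is determined by its values off a finite set `S` if it satisfies the
mean value property of the walk on `S`. -/
theorem le_of_harmonic (q : ℝ≥0) (S : Finset ℤ) (f g : ℤ → ℝ)
    (hf : ∀ j ∈ S, f j = (q / (1 + q) : ℝ) * f (j - 1) + (1 / (1 + q) : ℝ) * f (j + 1))
    (hg : ∀ j ∈ S, g j = (q / (1 + q) : ℝ) * g (j - 1) + (1 / (1 + q) : ℝ) * g (j + 1))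
    (h : ∀ j ∉ S, f j = g j) (j : ℤ) : f j ≤ g j := by
  by_contra! hj
  have hjS : j ∈ S := by
    by_contra hjS
    exact hj.ne' (h j hjS)
  obtain ⟨m, hmS, hm⟩ := S.exists_max_image (fun i => f i - g i) ⟨j, hjS⟩
  have hpos : 0 < f m - g m := lt_of_lt_of_le (sub_pos.2 hj) (hm j hjS)
  have hle : ∀ i, f i - g i ≤ f m - g m := fun i => by
    by_cases hi : i ∈ S
    · exact hm i hi
    · rw [h i hi, sub_self]; exact hpos.le
  have hq : (0 : ℝ) < 1 + q := by positivity
  have key : ∀ i ∈ S, f i - g i = f m - g m →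
      f (i + 1) - g (i + 1) = f m - g m := fun i hi e => by
    have e1 := hf i hi
    have e2 := hg i hi
    field_simp at e1 e2
    have h1 := mul_le_mul_of_nonneg_left (hle (i - 1)) q.coe_nonneg
    have h2 := hle (i + 1)
    have h3 : (1 + (q : ℝ)) * (f i - g i) = (1 + (q : ℝ)) * (f m - g m) := by rw [e]
    nlinarith
  have all : ∀ k : ℕ, f (m + k) - g (m + k) = f m - g m := fun k => by
    induction k with
    | zero => simp
    | succ k ih =>
      have hk : m + k ∈ S := by
        by_contra hk
        rw [h _ hk, sub_self] at ih
        exact hpos.ne ih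
      have := key _ hk ih
      push_cast
      rwa [← add_assoc]
  have inS : ∀ k : ℕ, m + (k : ℤ) ∈ S := fun k => by
    by_contra hk
    have := all k
    rw [h _ hk, sub_self] at this
    exact hpos.ne this
  exact Set.infinite_of_injective_forall_mem (s := (S : Set ℤ)) (f := fun k : ℕ => m + (k : ℤ))
    (fun a b hab => by simpa using hab) inS S.finite_toSet

theorem eq_of_harmonic (q : ℝ≥0) (S : Finset ℤ) (f g : ℤ → ℝ≥0∞)
    (hf0 : ∀ j, f j ≠ ⊤) (hg0 : ∀ j, g j ≠ ⊤)
    (hf : ∀ j ∈ S, f j = ((q / (1 + q) : ℝ≥0) : ℝ≥0∞) * f (j - 1) +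
      ((1 / (1 + q) : ℝ≥0) : ℝ≥0∞) * f (j + 1))
    (hg : ∀ j ∈ S, g j = ((q / (1 + q) : ℝ≥0) : ℝ≥0∞) * g (j - 1) +
      ((1 / (1 + q) : ℝ≥0) : ℝ≥0∞) * g (j + 1))
    (h : ∀ j ∉ S, f j = g j) (j : ℤ) : f j = g j := by
  have aux : ∀ f : ℤ → ℝ≥0∞, (∀ j, f j ≠ ⊤) →
      (∀ j ∈ S, f j = ((q / (1 + q) : ℝ≥0) : ℝ≥0∞) * f (j - 1) +
        ((1 / (1 + q) : ℝ≥0) : ℝ≥0∞) * f (j + 1)) →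
      ∀ j ∈ S, (f j).toReal = (q / (1 + q) : ℝ) * (f (j - 1)).toReal +
        (1 / (1 + q) : ℝ) * (f (j + 1)).toReal := fun f h0 hf j hj => by
    rw [hf j hj, ENNReal.toReal_add (ENNReal.mul_ne_top ENNReal.coe_ne_top (h0 _))
      (ENNReal.mul_ne_top ENNReal.coe_ne_top (h0 _)), ENNReal.toReal_mul, ENNReal.toReal_mul,
      ENNReal.coe_toReal, ENNReal.coe_toReal]
    push_cast
    rfl
  refine (ENNReal.toReal_eq_toReal_iff' (hf0 j) (hg0 j)).1 (le_antisymm ?_ ?_)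
  · exact le_of_harmonic q S (fun i => (f i).toReal) (fun i => (g i).toReal) (aux f hf0 hf)
      (aux g hg0 hg) (fun i hi => by rw [h i hi]) j
  · exact le_of_harmonic q S (fun i => (g i).toReal) (fun i => (f i).toReal) (aux g hg0 hg)
      (aux f hf0 hf) (fun i hi => by rw [h i hi]) j

theorem endProb_swap_of_notMem (q : ℝ≥0) (T S : Finset ℤ) (i j : ℤ) (u : List ℤ) (hi : i ∉ S) :
    endProb q T (S, i :: j :: u) = endProb q T (S, j :: i :: u) := by
  refine eq_of_harmonic q S (fun j => endProb q T (S, i :: j :: u))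
    (fun j => endProb q T (S, j :: i :: u)) (fun _ => endProb_ne_top _ _ _)
    (fun _ => endProb_ne_top _ _ _) (fun j hj => ?_) (fun j hj => ?_) (fun j hj => ?_) j
  · simp only [endProb_notMem q T S i _ hi]
    exact endProb_mem q T _ j u (Finset.mem_insert_of_mem hj)
  · exact endProb_mem q T S j _ hj
  · simp only [endProb_notMem q T S i _ hi, endProb_notMem q T S j _ hj]
    by_cases hij : i = j
    · rw [hij]
    · rw [endProb_notMem q T _ j u (by simp [hj, Ne.symm hij]),
        endProb_notMem q T _ i u (by simp [hi, hij]), Finset.insert_comm]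

theorem endProb_swap (q : ℝ≥0) (T S : Finset ℤ) (i j : ℤ) (u : List ℤ) :
    endProb q T (S, i :: j :: u) = endProb q T (S, j :: i :: u) := by
  refine eq_of_harmonic q S (fun i => endProb q T (S, i :: j :: u))
    (fun i => endProb q T (S, j :: i :: u)) (fun _ => endProb_ne_top _ _ _)
    (fun _ => endProb_ne_top _ _ _) (fun i hi => endProb_mem q T S i _ hi) (fun i hi => ?_)
    (fun i hi => endProb_swap_of_notMem q T S i j u hi) i
  have fin : ∀ (a b : ℝ≥0) (x y : State),
      (a : ℝ≥0∞) * endProb q T x + (b : ℝ≥0∞) * endProb q T y ≠ ⊤ := fun a b x y =>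
    ENNReal.add_ne_top.2 ⟨ENNReal.mul_ne_top ENNReal.coe_ne_top (endProb_ne_top _ _ _),
      ENNReal.mul_ne_top ENNReal.coe_ne_top (endProb_ne_top _ _ _)⟩
  refine eq_of_harmonic q S (fun j => endProb q T (S, j :: i :: u))
    (fun j => ((q / (1 + q) : ℝ≥0) : ℝ≥0∞) * endProb q T (S, j :: (i - 1) :: u) +
      ((1 / (1 + q) : ℝ≥0) : ℝ≥0∞) * endProb q T (S, j :: (i + 1) :: u))
    (fun _ => endProb_ne_top _ _ _) (fun _ => fin _ _ _ _)
    (fun j hj => endProb_mem q T S j _ hj) (fun j hj => ?_) (fun j hj => ?_) j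
  · rw [endProb_mem q T S j ((i - 1) :: u) hj, endProb_mem q T S j ((i + 1) :: u) hj]
    ring
  · simp only [endProb_notMem q T S j _ hj]
    exact endProb_mem q T _ i u (Finset.mem_insert_of_mem hi)

/-- Insert the same ball in front of two orders that give the same probabilities. -/
theorem endProb_cons_congr (q : ℝ≥0) (T : Finset ℤ) (u v : List ℤ)
    (h : ∀ S, endProb q T (S, u) = endProb q T (S, v)) (S : Finset ℤ) (i : ℤ) :
    endProb q T (S, i :: u) = endProb q T (S, i :: v) := by
  refine eq_of_harmonic q S (fun i => endProb q T (S, i :: u)) (fun i => endProb q T (S, i :: v))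
    (fun _ => endProb_ne_top _ _ _) (fun _ => endProb_ne_top _ _ _)
    (fun i hi => endProb_mem q T S i _ hi) (fun i hi => endProb_mem q T S i _ hi)
    (fun i hi => ?_) i
  simp only [endProb_notMem q T S i _ hi]
  exact h _

/-- The probability that the final support is `T` does not depend on the order in which the balls
are dropped. -/
theorem endProb_perm (q : ℝ≥0) (T : Finset ℤ) {u v : List ℤ} (h : u.Perm v) :
    ∀ S, endProb q T (S, u) = endProb q T (S, v) := by
  induction h with
  | nil => exact fun _ => rfl
  | cons i _ ih => exact fun S => endProb_cons_congr q T _ _ ih S i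
  | swap i j u => exact fun S => endProb_swap q T S j i u
  | trans _ _ ih1 ih2 => exact fun S => (ih1 S).trans (ih2 S)

/-- The probability that the final support is `T` when balls are dropped, in any order, from the
sites in the multiset `M` onto the empty line. -/
noncomputable def supportProb (q : ℝ≥0) (T : Finset ℤ) (M : Multiset ℤ) : ℝ :=
  Quotient.liftOn M (fun u => (endProb q T (∅, u)).toReal) fun _ _ h =>
    congrArg ENNReal.toReal (endProb_perm q T h ∅)

/-! ### `q`-analogues -/

/-- The `q`-integer `[n] = 1 + q + ⋯ + q ^ (n - 1)`. -/
def qInt (q : ℝ) (n : ℕ) : ℝ := ∑ k ∈ Finset.range n, q ^ k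

/-- The `q`-factorial `[n]! = [1] [2] ⋯ [n]`. -/
def qFact (q : ℝ) (n : ℕ) : ℝ := ∏ i ∈ Finset.Icc 1 n, qInt q i

/-- The `q`-binomial coefficient `[n]! / ([k]! [n - k]!)`, for `k ≤ n`. -/
noncomputable def qBinom (q : ℝ) (n k : ℕ) : ℝ := qFact q n / (qFact q k * qFact q (n - k))

/-- The `q`-Pochhammer symbol `(t; q)_n`, as a formal power series in `t`. -/
noncomputable def qPoch (q : ℝ) (n : ℕ) : PowerSeries ℝ :=
  ∏ i ∈ Finset.range n, (1 - PowerSeries.X * PowerSeries.C (q ^ i))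

/-! ### Remixed Eulerian numbers -/

/-- A configuration: a tuple `(c_1, …, c_n)` of natural numbers with sum `n`. -/
structure Configuration where
  toList : List ℕ
  sum_eq : toList.sum = toList.length

/-- The number of balls, which is also the number of sites. -/
def Configuration.size (c : Configuration) : ℕ := c.toList.length

/-- The multiset of starting sites of the balls: it holds each site `i ∈ {1, …, n}` exactly `c_i`
times. -/
def Configuration.mset (c : Configuration) : Multiset ℤ :=
  ∑ i : Fin c.toList.length, Multiset.replicate (c.toList.get i) ((i : ℤ) + 1)

/-- The remixed Eulerian number `A_c(q) = [n]! P(c → {1, …, n})_q`. -/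
noncomputable def remixedEulerian (q : ℝ≥0) (c : Configuration) : ℝ :=
  qFact q c.size * supportProb q (Finset.Icc 1 (c.size : ℤ)) c.mset

/-- The configuration `(0^r, 1^(y-1), r+s+1, 1^(x-1), 0^s)`. -/
def csConfig (r s x y : ℕ) : Configuration where
  toList := List.replicate r 0 ++ List.replicate (y - 1) 1 ++ [r + s + 1] ++
    List.replicate (x - 1) 1 ++ List.replicate s 0
  sum_eq := by
    simp only [List.sum_append, List.sum_replicate, List.length_append, List.length_replicate,
      List.sum_cons, List.sum_nil, List.length_cons, List.length_nil, smul_eq_mul]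
    lia

/-- The `q`-analogue `A(r,s|x,y)_q` of the Carlitz–Scoville generalised Eulerian numbers, for
positive `x` and `y`. -/
noncomputable def csEulerian (q : ℝ≥0) (r s x y : ℕ) : ℝ :=
  remixedEulerian q (csConfig r s x y) / qFact q (x + y - 1)

end RemixedEulerian

namespace RemixedEulerian

open PowerSeries

/-! ### `q`-analogues -/

/-! The final law does not depend on the order, so one ball per site of the interval of length
$x+y-1$ can be dropped first. The other $r+s$ balls all start at the same site $p=r+y$, and the
occupied set remains an interval. By the gambler's ruin (`toReal_endProb_Icc`), when $k$ extra balls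
have settled, $i$ of them to the left, the next one extends the interval to the right with
probability $[i+y]/[x+y+k]$. With the denominators cleared, the law of $i$ obeys the coefficient
recursion of $F_{k+1}=(1-t)DF_k+[x+y+k]\,tF_k$, where $D$ multiplies $t^j$ by $[j+y]$ (`csPoly`,
`csEulerian_eq_coeff`).

The series $G_m=\sum_j t^j\genfrac{[}{]}{0pt}{}{j+x+y-1}{j}[j+y]^m$ satisfies $G_{m+1}=DG_m$, and
$G_0=1/(t;q)_{x+y}$ by the `q`-binomial series. A twisted Leibniz rule for $D$ shows that
$G_m\,(t;q)_{m+x+y}$ obeys the recursion of $F_m$, so the two agree (`mk_mul_qPoch`). The explicit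
formula follows by expanding $(t;q)_{r+s+x+y}$ with the `q`-binomial theorem. -/

theorem qInt_mul_one_sub (q : ℝ) (n : ℕ) : qInt q n * (1 - q) = 1 - q ^ n := by
  have := geom_sum_mul q n
  unfold qInt
  linarith

theorem qInt_zero (q : ℝ) : qInt q 0 = 0 := by simp [qInt]

theorem qInt_succ (q : ℝ) (n : ℕ) : qInt q (n + 1) = qInt q n + q ^ n := by
  simp [qInt, Finset.sum_range_succ]

theorem qInt_add (q : ℝ) (m n : ℕ) : qInt q (m + n) = qInt q m + q ^ m * qInt q n := by
  simp [qInt, Finset.sum_range_add, pow_add, Finset.mul_sum]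

theorem qInt_pos {q : ℝ} (hq : 0 ≤ q) {n : ℕ} (hn : 0 < n) : 0 < qInt q n := by
  obtain ⟨n, rfl⟩ := Nat.exists_eq_succ_of_ne_zero hn.ne'
  rw [qInt, Finset.sum_range_succ', pow_zero]
  positivity

theorem qFact_zero (q : ℝ) : qFact q 0 = 1 := by simp [qFact]

theorem qFact_succ (q : ℝ) (n : ℕ) : qFact q (n + 1) = qFact q n * qInt q (n + 1) := by
  simp [qFact, Finset.prod_Icc_succ_top]

theorem qFact_pos {q : ℝ} (hq : 0 ≤ q) (n : ℕ) : 0 < qFact q n :=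
  Finset.prod_pos fun _ hi => qInt_pos hq (Finset.mem_Icc.1 hi).1

theorem qBinom_zero_right {q : ℝ} (hq : 0 ≤ q) (n : ℕ) : qBinom q n 0 = 1 := by
  simp [qBinom, qFact_zero, (qFact_pos hq n).ne']

theorem qBinom_self {q : ℝ} (hq : 0 ≤ q) (n : ℕ) : qBinom q n n = 1 := by
  simp [qBinom, qFact_zero, (qFact_pos hq n).ne']

/-- The `q`-Pascal rule, from $[m+k+2]=[m+1]+q^{m+1}[k+1]$. Upper indices are written as sums so
that the truncated subtraction in `qBinom` cancels. -/
theorem qBinom_add_succ_succ {q : ℝ} (hq : 0 ≤ q) (m k : ℕ) :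
    qBinom q (k + 1 + (m + 1)) (k + 1) =
      qBinom q (k + 1 + m) (k + 1) + q ^ (m + 1) * qBinom q (k + (m + 1)) k := by
  have e : k + 1 + (m + 1) = (m + 1 + k) + 1 := by ring
  have h := qInt_add q (m + 1) (k + 1)
  have hm := (qInt_pos hq m.succ_pos).ne'
  have hk := (qInt_pos hq k.succ_pos).ne'
  have hm' := (qFact_pos hq m).ne'
  have hk' := (qFact_pos hq k).ne'
  simp only [qBinom, Nat.add_sub_cancel_left]
  rw [e, qFact_succ q (m + 1 + k), show k + 1 + m = m + 1 + k by ring,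
    show k + (m + 1) = m + 1 + k by ring, qFact_succ q m, qFact_succ q k,
    show m + 1 + k + 1 = m + 1 + (k + 1) by ring, h]
  simp only [Nat.succ_eq_add_one] at hm hk
  field_simp

/-! ### The `q`-Pochhammer symbol -/

theorem qPoch_zero (q : ℝ) : qPoch q 0 = 1 := by simp [qPoch]

theorem qPoch_succ (q : ℝ) (n : ℕ) : qPoch q (n + 1) = qPoch q n * (1 - X * C (q ^ n)) := by
  simp [qPoch, Finset.prod_range_succ]

theorem constantCoeff_qPoch (q : ℝ) (n : ℕ) : constantCoeff (qPoch q n) = 1 := by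
  simp [qPoch, map_prod]

theorem coeff_succ_mul_one_sub_X_mul_C (f : PowerSeries ℝ) (a : ℝ) (n : ℕ) :
    coeff (n + 1) (f * (1 - X * C a)) = coeff (n + 1) f - a * coeff n f := by
  rw [mul_sub, mul_one, map_sub, mul_comm X, ← mul_assoc, coeff_succ_mul_X, coeff_mul_C, mul_comm]

/-- The `q`-binomial theorem. -/
theorem coeff_qPoch {q : ℝ} (hq : 0 ≤ q) (n k : ℕ) (hk : k ≤ n) :
    coeff k (qPoch q n) = (-1) ^ k * q ^ k.choose 2 * qBinom q n k := by
  -- For $k>n$ truncated subtraction makes `qBinom q n k` nonzero, so the vanishing above degree $n$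
  -- is proved separately; it is needed for the top coefficient.
  have hz : ∀ n k : ℕ, n < k → coeff k (qPoch q n) = 0 := fun n => by
    induction n with
    | zero => intro k hk; rw [qPoch_zero, coeff_one, if_neg hk.ne']
    | succ n ih =>
      intro k hk
      obtain ⟨k, rfl⟩ := Nat.exists_eq_succ_of_ne_zero (by lia : k ≠ 0)
      rw [Nat.succ_eq_add_one, qPoch_succ, coeff_succ_mul_one_sub_X_mul_C, ih _ (by lia),
        ih _ (by lia)]
      simp
  induction n generalizing k with
  | zero =>
    obtain rfl : k = 0 := by lia
    simp [qPoch_zero, qBinom_zero_right hq]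
  | succ n ih =>
    cases k with
    | zero =>
      rw [coeff_zero_eq_constantCoeff, constantCoeff_qPoch, qBinom_zero_right hq]
      simp
    | succ k =>
      rw [qPoch_succ, coeff_succ_mul_one_sub_X_mul_C, ih k (by lia),
        show (k + 1).choose 2 = k + k.choose 2 by simp [Nat.choose_succ_succ']]
      rcases Nat.lt_or_ge k n with h | h
      · obtain ⟨m, rfl⟩ := Nat.exists_eq_add_of_lt h
        rw [ih (k + 1) (by lia), show (k + 1).choose 2 = k + k.choose 2 by
            simp [Nat.choose_succ_succ'], show k + m + 1 + 1 = k + 1 + (m + 1) by ring,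
          qBinom_add_succ_succ hq m k, show k + m + 1 = k + 1 + m by ring,
          show k + (m + 1) = k + 1 + m by ring]
        ring
      · obtain rfl : n = k := by lia
        rw [hz _ _ (Nat.lt_succ_self n), qBinom_self hq, qBinom_self hq]
        ring

/-- The `q`-binomial series. -/
theorem mk_qBinom_mul_qPoch {q : ℝ} (hq : 0 ≤ q) (n : ℕ) :
    (mk fun j => qBinom q (j + n) j) * qPoch q (n + 1) = 1 := by
  induction n with
  | zero =>
    ext j
    rw [qPoch_succ, qPoch_zero, one_mul]
    cases j with
    | zero => simp [qBinom_self hq]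
    | succ j =>
      rw [coeff_succ_mul_one_sub_X_mul_C, coeff_mk, coeff_mk, coeff_one, add_zero, add_zero,
        qBinom_self hq, qBinom_self hq]
      simp
  | succ n ih =>
    rw [← ih, qPoch_succ q (n + 1), mul_comm (qPoch q (n + 1)), ← mul_assoc]
    congr 1
    ext j
    cases j with
    | zero => simp [qBinom_zero_right hq]
    | succ j =>
      rw [coeff_succ_mul_one_sub_X_mul_C, coeff_mk, coeff_mk, coeff_mk,
        qBinom_add_succ_succ hq n j]
      ring

/-! ### The `q`-derivation -/

/-- The operator that multiplies the coefficient of `t ^ j` by `[j + y]`. -/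
noncomputable def qEuler (q : ℝ) (y : ℕ) (f : PowerSeries ℝ) : PowerSeries ℝ :=
  mk fun j => qInt q (j + y) * coeff j f

theorem coeff_qEuler (q : ℝ) (y : ℕ) (f : PowerSeries ℝ) (j : ℕ) :
    coeff j (qEuler q y f) = qInt q (j + y) * coeff j f := coeff_mk _ _

/-- From $[y+j]=[y]+q^y[j]$; this reduces $D$ to the case $y=0$, where a Leibniz rule is available.
-/
theorem qEuler_eq (q : ℝ) (y : ℕ) (f : PowerSeries ℝ) :
    qEuler q y f = C (qInt q y) * f + C (q ^ y) * qEuler q 0 f := by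
  ext j
  simp only [map_add, coeff_C_mul, coeff_qEuler, add_zero]
  rw [add_comm j y, qInt_add]
  ring

/-- The twist comes from $[i+j]=[i]+q^i[j]$: the factor $q^i$ on the coefficient of $t^i$ is the
substitution $t\mapsto qt$ in `f`. -/
theorem qEuler_zero_mul (q : ℝ) (f g : PowerSeries ℝ) :
    qEuler q 0 (f * g) = qEuler q 0 f * g + rescale q f * qEuler q 0 g := by
  ext j
  simp only [map_add, coeff_mul, coeff_qEuler, coeff_rescale, add_zero, Finset.mul_sum,
    ← Finset.sum_add_distrib]
  refine Finset.sum_congr rfl fun p hp => ?_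
  rw [← Finset.HasAntidiagonal.mem_antidiagonal.1 hp, qInt_add]
  ring

theorem rescale_qPoch_mul (q : ℝ) (n : ℕ) :
    rescale q (qPoch q n) * (1 - X) = qPoch q (n + 1) := by
  simp only [qPoch, map_prod, Finset.prod_range_succ' _ n, pow_zero, map_one, mul_one]
  congr 1
  refine Finset.prod_congr rfl fun i _ => ?_
  have hC : rescale q (C (q ^ i)) = C (q ^ i) := by
    ext k
    rw [coeff_rescale, coeff_C]
    split_ifs with h <;> simp [h]
  rw [map_sub, map_one, map_mul, rescale_X, hC, pow_succ, map_mul]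
  ring

/-- For $n\ge 1$ the operator sends $(t;q)_n$ to $-[n]\,t\,(qt;q)_{n-1}$; the factor $1-t$ completes
this to $(t;q)_n$ and avoids the index $n-1$. -/
theorem qEuler_zero_qPoch (q : ℝ) (n : ℕ) :
    qEuler q 0 (qPoch q n) * (1 - X) = -(C (qInt q n) * X * qPoch q n) := by
  induction n with
  | zero =>
    have : qEuler q 0 1 = 0 := by
      ext j
      rcases eq_or_ne j 0 with rfl | h <;> simp [coeff_qEuler, coeff_one, qInt_zero, *]
    simp [qPoch_zero, this, qInt_zero]
  | succ n ih =>
    have h : qEuler q 0 (1 - X * C (q ^ n)) = -(X * C (q ^ n)) := by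
      generalize q ^ n = a
      ext j
      rcases j with _ | _ | j <;>
        simp [coeff_qEuler, coeff_one, qInt_zero, qInt_succ, coeff_X]
    have h' := rescale_qPoch_mul q n
    rw [qPoch_succ] at h' ⊢
    rw [qEuler_zero_mul, h, qInt_succ, map_add]
    linear_combination (1 - X * C (q ^ n)) * ih - X * C (q ^ n) * h'

/-- The polynomials with `F_0 = 1` and `F_{m + 1} = (1 - t) D F_m + [x + y + m] t F_m`, where `D`
multiplies the coefficient of `t ^ j` by `[j + y]`. -/
noncomputable def csPoly (q : ℝ) (x y : ℕ) : ℕ → PowerSeries ℝ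
  | 0 => 1
  | m + 1 => (1 - X) * qEuler q y (csPoly q x y m) + C (qInt q (m + x + y)) * X * csPoly q x y m

theorem coeff_csPoly_succ_zero (q : ℝ) (x y m : ℕ) :
    coeff 0 (csPoly q x y (m + 1)) = qInt q y * coeff 0 (csPoly q x y m) := by
  simp only [csPoly, sub_mul, one_mul, mul_assoc, map_add, map_sub, coeff_zero_X_mul, coeff_C_mul,
    coeff_qEuler, zero_add, mul_zero, sub_zero, add_zero]

theorem coeff_csPoly_succ_succ (q : ℝ) (x y m i : ℕ) :
    coeff (i + 1) (csPoly q x y (m + 1)) = qInt q (i + 1 + y) * coeff (i + 1) (csPoly q x y m) +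
      (qInt q (m + x + y) - qInt q (i + y)) * coeff i (csPoly q x y m) := by
  simp only [csPoly, sub_mul, one_mul, mul_assoc, map_add, map_sub, coeff_succ_X_mul, coeff_C_mul,
    coeff_qEuler]
  ring

theorem coeff_csPoly_of_lt (q : ℝ) (x y m i : ℕ) (h : m < i) :
    coeff i (csPoly q x y m) = 0 := by
  induction m generalizing i with
  | zero => rw [csPoly, coeff_one, if_neg h.ne']
  | succ m ih =>
    obtain ⟨i, rfl⟩ := Nat.exists_eq_succ_of_ne_zero (by lia : i ≠ 0)
    rw [Nat.succ_eq_add_one, coeff_csPoly_succ_succ, ih _ (by lia), ih _ (by lia)]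
    simp

/-- In the Leibniz rule the Pochhammer symbol is taken as the first factor, so that the twist falls
on it and $1-t$ turns $(qt;q)_n$ into $(t;q)_{n+1}$. -/
theorem qEuler_mul_qPoch (q : ℝ) (y n : ℕ) (g : PowerSeries ℝ) :
    qEuler q y g * qPoch q (n + 1) =
      (1 - X) * qEuler q y (g * qPoch q n) + C (qInt q n) * X * (g * qPoch q n) := by
  have h1 := rescale_qPoch_mul q n
  have h2 := qEuler_zero_qPoch q n
  -- Both sides are $(1-q)[y][n]$; in this form the identity needs no division by $1-q$ and covers
  -- $q=1$.
  have h5 : C (qInt q y) * (1 - C (q ^ n)) = C (qInt q n) * (1 - C (q ^ y)) := by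
    rw [← map_one (C (R := ℝ)), ← map_sub, ← map_sub, ← qInt_mul_one_sub, ← qInt_mul_one_sub,
      ← map_mul, ← map_mul]
    ring_nf
  rw [qEuler_eq q y (g * _), mul_comm g, qEuler_zero_mul, qEuler_eq q y g]
  rw [qPoch_succ] at h1 ⊢
  linear_combination (-C (q ^ y) * qEuler q 0 g) * h1 - C (q ^ y) * g * h2 +
    X * g * qPoch q n * h5

theorem mk_mul_qPoch {q : ℝ} (hq : 0 ≤ q) (x y : ℕ) (hx : 1 ≤ x) (m : ℕ) :
    (mk fun j => qBinom q (j + x + y - 1) j * qInt q (j + y) ^ m) * qPoch q (m + x + y) =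
      csPoly q x y m := by
  induction m with
  | zero =>
    have := mk_qBinom_mul_qPoch hq (x - 1 + y)
    rw [show x - 1 + y + 1 = 0 + x + y by lia] at this
    simp only [pow_zero, mul_one, csPoly, ← this]
    congr 3
    ext j
    congr 1
    lia
  | succ m ih =>
    have h : (mk fun j => qBinom q (j + x + y - 1) j * qInt q (j + y) ^ (m + 1)) =
        qEuler q y (mk fun j => qBinom q (j + x + y - 1) j * qInt q (j + y) ^ m) := by
      ext j
      rw [coeff_qEuler, coeff_mk, coeff_mk]
      ring
    rw [h, show m + 1 + x + y = m + x + y + 1 by ring, qEuler_mul_qPoch, ih, csPoly]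

/-! ### The multiset of a configuration -/

/-- The multiset that holds the site `c + i + 1` as often as the entry of index `i` of `l` says. -/
def siteMultiset (c : ℤ) (l : List ℕ) : Multiset ℤ :=
  ∑ i : Fin l.length, Multiset.replicate (l.get i) (c + i + 1)

theorem siteMultiset_nil (c : ℤ) : siteMultiset c [] = 0 := rfl

theorem siteMultiset_cons (c : ℤ) (k : ℕ) (l : List ℕ) :
    siteMultiset c (k :: l) = Multiset.replicate k (c + 1) + siteMultiset (c + 1) l := by
  unfold siteMultiset
  refine (Fin.sum_univ_succ (n := l.length) _).trans ?_
  congr 1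
  · simp
  · refine Finset.sum_congr rfl fun i _ => ?_
    congr 1
    rw [Fin.val_succ]
    push_cast
    ring

theorem siteMultiset_append (c : ℤ) (l l' : List ℕ) :
    siteMultiset c (l ++ l') = siteMultiset c l + siteMultiset (c + l.length) l' := by
  induction l generalizing c with
  | nil => simp [siteMultiset_nil]
  | cons k l ih =>
    rw [List.cons_append, siteMultiset_cons, siteMultiset_cons, ih, List.length_cons,
      Nat.cast_succ, add_comm (l.length : ℤ) 1, ← add_assoc c, ← add_assoc]

theorem siteMultiset_replicate_zero (c : ℤ) (n : ℕ) :
    siteMultiset c (List.replicate n 0) = 0 := by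
  induction n generalizing c with
  | zero => rfl
  | succ n ih => simp [List.replicate_succ, siteMultiset_cons, ih]

theorem count_siteMultiset_replicate_one (c : ℤ) (n : ℕ) (a : ℤ) :
    (siteMultiset c (List.replicate n 1)).count a = if c < a ∧ a ≤ c + n then 1 else 0 := by
  induction n generalizing c with
  | zero => rw [if_neg (by simp)]; simp [siteMultiset_nil]
  | succ n ih =>
    rw [List.replicate_succ, siteMultiset_cons, Multiset.count_add, ih, Multiset.replicate_one,
      Multiset.count_singleton]
    push_cast
    split_ifs <;> lia

/-- One of the $r+s+1$ balls at the peak fills the gap between the two runs of ones; the other $r+s$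
are the extra balls. -/
theorem mset_csConfig (r s x y : ℕ) (hx : 1 ≤ x) (hy : 1 ≤ y) :
    (csConfig r s x y).mset =
      (Finset.Icc (r + 1 : ℤ) (r + x + y - 1)).val + Multiset.replicate (r + s) (r + y : ℤ) := by
  have h : (csConfig r s x y).mset = siteMultiset 0 (csConfig r s x y).toList := by
    simp [Configuration.mset, siteMultiset]
  rw [h]
  ext a
  simp only [csConfig, siteMultiset_append, siteMultiset_replicate_zero, siteMultiset_cons,
    siteMultiset_nil, Multiset.count_add, count_siteMultiset_replicate_one,
    Multiset.count_replicate, Multiset.count_zero, List.length_append, List.length_replicate,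
    List.length_cons, List.length_nil,
    Multiset.count_eq_of_nodup (Finset.Icc (r + 1 : ℤ) (r + x + y - 1)).nodup, Finset.mem_val,
    Finset.mem_Icc]
  push_cast [hx, hy]
  split_ifs <;> lia

/-! ### The probabilities of the final supports -/

theorem endProb_append_of_nodup (q : ℝ≥0) (T : Finset ℤ) (l u : List ℤ) (hl : l.Nodup)
    (S : Finset ℤ) (hS : ∀ j ∈ l, j ∉ S) :
    endProb q T (S, l ++ u) = endProb q T (S ∪ l.toFinset, u) := by
  induction l generalizing S with
  | nil => simp
  | cons j l ih =>
    rw [List.nodup_cons] at hl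
    rw [List.cons_append, endProb_notMem q T S j _ (hS j List.mem_cons_self), ih hl.2]
    · congr 2
      ext a
      simp
    · intro i hi
      rw [Finset.mem_insert, not_or]
      exact ⟨fun e => hl.1 (e ▸ hi), hS i (List.mem_cons_of_mem _ hi)⟩

theorem supportProb_val_add_replicate (q : ℝ≥0) (T S : Finset ℤ) (n : ℕ) (p : ℤ) :
    supportProb q T (S.val + Multiset.replicate n p) =
      (endProb q T (S, List.replicate n p)).toReal := by
  have h : S.val + Multiset.replicate n p = ((S.toList ++ List.replicate n p : List ℤ) :
      Multiset ℤ) := by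
    rw [← Multiset.coe_add, Finset.coe_toList, Multiset.coe_replicate]
  rw [h]
  -- Order independence is used here: the lift is evaluated at the order that fills `S` first.
  change (endProb q T (∅, S.toList ++ List.replicate n p)).toReal = _
  rw [endProb_append_of_nodup q T _ _ S.nodup_toList ∅ (by simp), Finset.empty_union,
    Finset.toList_toFinset]

theorem toReal_endProb_mem (q : ℝ≥0) (T S : Finset ℤ) (j : ℤ) (u : List ℤ) (h : j ∈ S) :
    (endProb q T (S, j :: u)).toReal =
      (q / (1 + q) : ℝ) * (endProb q T (S, (j - 1) :: u)).toReal +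
      (1 / (1 + q) : ℝ) * (endProb q T (S, (j + 1) :: u)).toReal := by
  rw [endProb_mem q T S j u h, ENNReal.toReal_add
      (ENNReal.mul_ne_top ENNReal.coe_ne_top (endProb_ne_top _ _ _))
      (ENNReal.mul_ne_top ENNReal.coe_ne_top (endProb_ne_top _ _ _)), ENNReal.toReal_mul,
    ENNReal.toReal_mul, ENNReal.coe_toReal, ENNReal.coe_toReal]
  push_cast
  rfl

/-- The gambler's ruin: a ball dropped on a filled interval leaves it on the right with probability
`[d] / [d + e]`, where `d` and `e` are the distances to the holes on the left and on the right. -/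
theorem toReal_endProb_Icc (q : ℝ≥0) (T : Finset ℤ) (u : List ℤ) (p : ℤ) (d e : ℕ)
    (hd : 1 ≤ d) :
    (endProb q T (Finset.Icc (p - d + 1) (p + e - 1), p :: u)).toReal * qInt q (d + e) =
      qInt q d * (endProb q T (Finset.Icc (p - d + 1) (p + e), u)).toReal +
      (qInt q (d + e) - qInt q d) *
        (endProb q T (Finset.Icc (p - d) (p + e - 1), u)).toReal := by
  set S := Finset.Icc (p - d + 1) (p + e - 1) with hS
  set R := (endProb q T (Finset.Icc (p - d + 1) (p + e), u)).toReal
  set L := (endProb q T (Finset.Icc (p - d) (p + e - 1), u)).toReal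
  have hN : 0 < qInt q (d + e) :=
    Finset.sum_pos' (fun _ _ => by positivity) ⟨0, by simp; lia, by simp⟩
  -- The sequence $[k]$ has the mean value property, since $[k+1]-[k]=q([k]-[k-1])$. Thus `w` is the
  -- harmonic function with the value `L` at the left hole and `R` at the right one.
  let w : ℕ → ℝ := fun k => (qInt q k * R + (qInt q (d + e) - qInt q k) * L) / qInt q (d + e)
  let f : ℤ → ℝ := fun j => (endProb q T (S, j :: u)).toReal
  -- The uniqueness principle asks for agreement at every site off `S`, hence the value `f j` beyond
  -- the two holes.
  let g : ℤ → ℝ := fun j =>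
    if p - d ≤ j ∧ j ≤ p + e then w (j - (p - d)).toNat else f j
  have hwin : ∀ k : ℕ, k ≤ d + e → g (p - d + k) = w k := fun k hk => by
    have : p - d ≤ p - d + k ∧ p - d + k ≤ p + (e : ℤ) := by lia
    simp only [g, if_pos this]
    congr 1
    lia
  have hf : ∀ j ∈ S, f j = (q / (1 + q) : ℝ) * f (j - 1) + (1 / (1 + q) : ℝ) * f (j + 1) :=
    fun j hj => toReal_endProb_mem q T S j u hj
  have hg : ∀ j ∈ S, g j = (q / (1 + q) : ℝ) * g (j - 1) + (1 / (1 + q) : ℝ) * g (j + 1) := by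
    intro j hj
    rw [hS, Finset.mem_Icc] at hj
    obtain ⟨k, rfl⟩ : ∃ k : ℕ, j = p - d + (k + 1 : ℕ) := ⟨(j - (p - d) - 1).toNat, by lia⟩
    have e1 : p - d + (k + 1 : ℕ) - 1 = p - d + (k : ℕ) := by push_cast; ring
    have e2 : p - d + (k + 1 : ℕ) + 1 = p - d + (k + 2 : ℕ) := by push_cast; ring
    rw [e1, e2, hwin _ (by lia), hwin _ (by lia), hwin _ (by lia)]
    have h1 : qInt q (k + 1) = qInt q k + q ^ k := by simp [qInt, Finset.sum_range_succ]
    have h2 : qInt q (k + 2) = qInt q k + q ^ k + q ^ k * q := by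
      simp [qInt, Finset.sum_range_succ, pow_succ]
    have hq : (0 : ℝ) < 1 + q := by positivity
    simp only [w, h1, h2]
    field_simp
    ring
  have hfg : ∀ j ∉ S, f j = g j := by
    intro j hj
    rw [hS, Finset.mem_Icc] at hj
    by_cases h : p - d ≤ j ∧ j ≤ p + e
    · rcases (by lia : j = p - d ∨ j = p + e) with rfl | rfl
      · have := hwin 0 (by lia)
        rw [Nat.cast_zero, add_zero] at this
        rw [this]
        simp only [f, w, endProb_notMem q T S _ u (by rw [hS, Finset.mem_Icc]; exact hj)]
        rw [show insert (p - (d : ℤ)) S = Finset.Icc (p - d) (p + e - 1) by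
          ext a; simp only [hS, Finset.mem_insert, Finset.mem_Icc]; lia]
        change L = _
        simp [qInt]
        rw [mul_div_cancel_left₀ L (by simpa [qInt] using hN.ne')]
      · have := hwin (d + e) le_rfl
        rw [show p - d + (d + e : ℕ) = p + e by push_cast; ring] at this
        rw [this]
        simp only [f, w, endProb_notMem q T S _ u (by rw [hS, Finset.mem_Icc]; exact hj)]
        rw [show insert (p + (e : ℤ)) S = Finset.Icc (p - d + 1) (p + e) by
          ext a; simp only [hS, Finset.mem_insert, Finset.mem_Icc]; lia]
        change R = _
        rw [sub_self, zero_mul, add_zero, mul_div_cancel_left₀ R hN.ne']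
    · simp only [g, if_neg h]
  have key : f p = g p := le_antisymm (le_of_harmonic q S f g hf hg hfg p)
    (le_of_harmonic q S g f hg hf (fun j hj => (hfg j hj).symm) p)
  have hp := hwin d (by lia)
  rw [sub_add_cancel] at hp
  change f p * _ = _
  rw [key, hp]
  exact div_mul_cancel₀ _ hN.ne'

/-! ### Generating functions of the remixed Eulerian numbers -/

/-- Condition on the first `k` extra balls: `i` of them settle on the left with probability `coeff i
(csPoly q x y k)` divided by $[x+y]\cdots[x+y+k-1]$, the product of the gambler's ruin denominators.
The `n` balls still to drop vary in the induction, which takes one of them at each step. -/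
theorem toReal_endProb_replicate_mul_qFact (q : ℝ≥0) (T : Finset ℤ) (p : ℤ) (x y : ℕ) (hy : 1 ≤ y)
    (k n : ℕ) :
    (endProb q T (Finset.Icc (p - y + 1) (p + x - 1), List.replicate (k + n) p)).toReal *
        qFact q (x + y + k - 1) =
      qFact q (x + y - 1) * ∑ i ∈ Finset.range (k + 1), coeff i (csPoly q x y k) *
        (endProb q T (Finset.Icc (p - y - i + 1) (p + x + k - i - 1),
          List.replicate n p)).toReal := by
  induction k generalizing n with
  | zero => simp [csPoly, mul_comm]
  | succ k ih =>
    let E : ℕ → ℝ := fun i =>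
      (endProb q T (Finset.Icc (p - y - i + 1) (p + x + (k + 1 : ℕ) - i - 1),
        List.replicate n p)).toReal
    have hstep : ∀ i ∈ Finset.range (k + 1), coeff i (csPoly q x y k) *
        (endProb q T (Finset.Icc (p - y - i + 1) (p + x + k - i - 1),
          List.replicate (n + 1) p)).toReal * qInt q (x + y + k) =
        qInt q (i + y) * coeff i (csPoly q x y k) * E i +
          (qInt q (k + x + y) - qInt q (i + y)) * coeff i (csPoly q x y k) * E (i + 1) := by
      intro i hi
      have hi' : i ≤ k := Nat.lt_succ_iff.1 (Finset.mem_range.1 hi)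
      have h := toReal_endProb_Icc q T (List.replicate n p) p (i + y) (x + (k - i)) (by lia)
      rw [show i + y + (x + (k - i)) = k + x + y by lia] at h
      push_cast [hi'] at h
      simp only [E, show x + y + k = k + x + y by ring, List.replicate_succ]
      push_cast
      rw [show p - (y : ℤ) - i + 1 = p - (i + y) + 1 by ring,
        show p + (x : ℤ) + k - i - 1 = p + (x + (k - i)) - 1 by ring,
        show p + (x : ℤ) + (k + 1) - i - 1 = p + (x + (k - i)) by ring,
        show p - (y : ℤ) - (i + 1) + 1 = p - (i + y) by ring,
        show p + (x : ℤ) + (k + 1) - (i + 1) - 1 = p + (x + (k - i)) - 1 by ring, mul_assoc, h]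
      ring
    have hfact : qFact q (x + y + (k + 1) - 1) = qFact q (x + y + k - 1) * qInt q (x + y + k) := by
      rw [show x + y + (k + 1) - 1 = (x + y + k - 1) + 1 by lia, qFact_succ,
        show x + y + k - 1 + 1 = x + y + k by lia]
    rw [hfact, ← mul_assoc, show k + 1 + n = k + (n + 1) by ring, ih (n + 1), mul_assoc,
      Finset.sum_mul, Finset.sum_congr rfl hstep, Finset.sum_add_distrib]
    congr 1
    change _ = ∑ i ∈ Finset.range (k + 1 + 1), coeff i (csPoly q x y (k + 1)) * E i
    rw [Finset.sum_range_succ' _ (k + 1), coeff_csPoly_succ_zero]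
    simp only [coeff_csPoly_succ_succ, add_mul, Finset.sum_add_distrib]
    -- Shifts the index in the sum over extensions to the right; the top term vanishes because $F_k$
    -- has degree at most $k$.
    have h0 := Finset.sum_range_succ' (fun i => qInt q (i + y) * coeff i (csPoly q x y k) * E i)
      (k + 1)
    rw [Finset.sum_range_succ _ (k + 1), coeff_csPoly_of_lt q x y k (k + 1) (Nat.lt_succ_self k),
      mul_zero, zero_mul, add_zero, zero_add] at h0
    rw [h0]
    ring

/-- With no ball left to drop, the final interval starts at $r+1-i$, so only $i=r$ yields
$\{1,\dots,n\}$. -/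
theorem csEulerian_eq_coeff (q : ℝ≥0) (r s x y : ℕ) (hx : 1 ≤ x) (hy : 1 ≤ y) :
    csEulerian q r s x y = coeff r (csPoly q x y (r + s)) := by
  have hsize : (csConfig r s x y).size = x + y + (r + s) - 1 := by
    simp only [Configuration.size, csConfig, List.length_append, List.length_replicate,
      List.length_cons, List.length_nil]
    lia
  have hcast : ((x + y + (r + s) - 1 : ℕ) : ℤ) = x + y + (r + s) - 1 := by lia
  have h := toReal_endProb_replicate_mul_qFact q (Finset.Icc 1 (x + y + (r + s) - 1)) (r + y) x y
    hy (r + s) 0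
  rw [csEulerian, remixedEulerian, hsize, mset_csConfig r s x y hx hy, hcast,
    supportProb_val_add_replicate, div_eq_iff (qFact_pos q.coe_nonneg _).ne', mul_comm,
    mul_comm (coeff r _)]
  rw [show (r : ℤ) + y - y + 1 = r + 1 by ring, show (r : ℤ) + y + x - 1 = r + x + y - 1 by ring,
    add_zero] at h
  rw [h, Finset.sum_eq_single_of_mem r (Finset.mem_range.2 (by lia))]
  · rw [List.replicate_zero, endProb_nil, if_pos]
    · simp
    · push_cast
      congr 1 <;> ring
  · intro i _ hi
    rw [List.replicate_zero, endProb_nil, if_neg]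
    · simp
    · intro he
      -- The site 1 lies in the target and the site 0 does not, which forces the left end $r+1-i$ to
      -- be 1.
      have h1 := Finset.ext_iff.1 he 1
      have h2 := Finset.ext_iff.1 he 0
      have h3 := Finset.ext_iff.1 he (x + y + (r + s) - 1)
      simp only [Finset.mem_Icc] at h1 h2 h3
      lia

/-- The polynomial depends on $r$ and $s$ only through $r+s$, so all terms of the numerator are
coefficients of a single `csPoly`. -/
theorem sum_X_pow_mul_C_csEulerian (q : ℝ≥0) (r s x y : ℕ) (hx : 1 ≤ x) (hy : 1 ≤ y) :
    ∑ i ∈ Finset.range (r + s + 1), X ^ i * C (csEulerian q i (r + s - i) x y) =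
      csPoly q x y (r + s) := by
  ext j
  simp only [map_sum, coeff_mul_C, coeff_X_pow, ite_mul, one_mul, zero_mul]
  rw [Finset.sum_ite_eq]
  split_ifs with h
  · rw [csEulerian_eq_coeff q _ _ x y hx hy, Nat.add_sub_cancel'
      (Nat.lt_succ_iff.1 (Finset.mem_range.1 h))]
  · rw [coeff_csPoly_of_lt]
    rw [Finset.mem_range] at h
    lia

end RemixedEulerian

theorem mainTheorem6 (q : NNReal) (x y : ℕ) (hx : 1 ≤ x) (hy : 1 ≤ y) :
    (∀ r s : ℕ,
      (∑ i ∈ Finset.range (r + s + 1),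
          PowerSeries.X ^ i * PowerSeries.C (RemixedEulerian.csEulerian q i (r + s - i) x y)) *
        (RemixedEulerian.qPoch q (r + s + x + y))⁻¹ =
      PowerSeries.mk fun j =>
        RemixedEulerian.qBinom q (j + x + y - 1) j * RemixedEulerian.qInt q (j + y) ^ (r + s)) ∧
    (∀ r s : ℕ,
      RemixedEulerian.csEulerian q r s x y =
        ∑ j ∈ Finset.range (r + 1),
          (-1 : ℝ) ^ (r + j) * (q : ℝ) ^ (r - j).choose 2 *
            RemixedEulerian.qBinom q (j + x + y - 1) j *
            RemixedEulerian.qBinom q (r + s + x + y) (r - j) *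
            RemixedEulerian.qInt q (j + y) ^ (r + s)) := by
  refine ⟨fun r s => ?_, fun r s => ?_⟩
  · rw [RemixedEulerian.sum_X_pow_mul_C_csEulerian q r s x y hx hy,
      ← RemixedEulerian.mk_mul_qPoch q.coe_nonneg x y hx, mul_assoc, PowerSeries.mul_inv_cancel,
      mul_one]
    rw [RemixedEulerian.constantCoeff_qPoch]
    exact one_ne_zero
  · rw [RemixedEulerian.csEulerian_eq_coeff q r s x y hx hy,
      ← RemixedEulerian.mk_mul_qPoch q.coe_nonneg x y hx, PowerSeries.coeff_mul,
      Finset.Nat.sum_antidiagonal_eq_sum_range_succ_mk]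
    refine Finset.sum_congr rfl fun j hj => ?_
    have hj' : j ≤ r := Nat.lt_succ_iff.1 (Finset.mem_range.1 hj)
    have hsign : (-1 : ℝ) ^ (r + j) = (-1) ^ (r - j) := by
      rw [show r + j = (r - j) + 2 * j by lia, pow_add, pow_mul]
      simp
    rw [PowerSeries.coeff_mk, RemixedEulerian.coeff_qPoch q.coe_nonneg _ _ (by lia), hsign]
    ring
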